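/- Let $K$ be a number field with algebraic closure $\overline K$, let $a,b,c\in K[t]$ be polynomials such that $b^2-4c-2b$ is nonconstant, and put $\phi_t(x)=x^2+b(t)x+c(t)$. For each integer $N\ge 1$ let $Y^{\mathrm{pre}}(N)\subset\mathbb A^2$ be the algebraic set, in the coordinates $(x,t)$, defined by $\phi_t^N(x)=a(t)$, where $\phi_t^N$ is the $N$-th iterate of $\phi_t$ in $x$, and let $Y^{\mathrm{pre}}(N,1),\dots,Y^{\mathrm{pre}}(N,r_N)$ be its irreducible components over $\overline K$. Let $\deg_x Y^{\mathrm{pre}}(N,i)$ denote the degree in $x$ of the equation defining $Y^{\mathrm{pre}}(N,i)$ in $\mathbb A^2$. The points at infinity of $Y^{\mathrm{pre}}(N,i)$ are the points of the completion of its normalization (the nonsingular projective model of the curve) that do not lie on the normalization. Then there is a number field $K'$ with $K\subseteq K'\subset\overline K$ such that for every integer $N\geq 1$ and every $i\in\{1,\dots,r_N\}$ the curve $Y^{\mathrm{pre}}(N,i)$ is defined over $K'$ and has at least $$\frac{\deg_x Y^{\mathrm{pre}}(N,i)}{4\,(1+\deg(b^2-4c+4a))}$$ $K'$-rational points at infinity.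 Here the degree of the zero polynomial is taken to be $0$. -/

import Mathlib

open Polynomial

noncomputable section

/-- The quadratic family `φ_t(x) = x² + b(t) x + c(t)`, as an element of `K[t][x]`: the outer
variable is `x`, the inner one is `t`. -/
def quadFamily {K : Type*} [Field K] (b c : K[X]) : K[X][X] :=
  X ^ 2 + C b * X + C c

/-- The polynomial `φ_t^N(x) - a(t)`, where `φ_t^N` is the `N`-th iterate in the variable `x`. -/
def preimagePoly {K : Type*} [Field K] (a b c : K[X]) (N : ℕ) : K[X][X] :=
  (quadFamily b c).comp^[N] X - C a

/-- Extension of scalars `k[t][x] → L[t][x]`. -/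
def extendScalars (k L : Type*) [Field k] [Field L] [Algebra k L] : k[X][X] →+* L[X][X] :=
  mapRingHom (mapRingHom (algebraMap k L))

/-- The ideal of `L[t][x]` generated by the equation `φ_t^N(x) = a(t)` of `Y^pre(N)`. -/
def preimageIdeal {K : Type*} [Field K] (L : Type*) [Field L] [Algebra K L]
    (a b c : K[X]) (N : ℕ) : Ideal L[X][X] :=
  Ideal.span {extendScalars K L (preimagePoly a b c N)}

/-- `𝔭 ∩ k[t][x]`. If the plane curve with ideal `𝔭` is defined over `k`, this is the ideal of its
(unique) model over `k`. -/
def descendIdeal (k : Type*) {L : Type*} [Field k] [Field L] [Algebra k L]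
    (𝔭 : Ideal L[X][X]) : Ideal k[X][X] :=
  𝔭.comap (extendScalars k L)

instance descendIdeal_isPrime (k : Type*) {L : Type*} [Field k] [Field L] [Algebra k L]
    (𝔭 : Ideal L[X][X]) [𝔭.IsPrime] : (descendIdeal k 𝔭).IsPrime :=
  Ideal.comap_isPrime (extendScalars k L) 𝔭

/-- The closed subset of the plane over `L` with ideal `𝔭` is defined over the subfield `k`: the
ideal `𝔭` is generated by polynomials with coefficients in `k`. -/
def IsDefinedOver (k : Type*) {L : Type*} [Field k] [Field L] [Algebra k L]
    (𝔭 : Ideal L[X][X]) : Prop :=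
  ∃ 𝔮 : Ideal k[X][X], 𝔮.map (extendScalars k L) = 𝔭

/-- Let `A` be the coordinate ring of an integral affine curve `Y` over `k`. The closed points of
the complete nonsingular model `X` of `Y` are the nontrivial valuation rings of the function field
`Frac A` that contain `k`, and the points of the normalization of `Y` are those which contain `A`.
So the points of `Y` at infinity are the valuation rings that contain `k` but do not contain `A`
(they are automatically nontrivial). -/
def pointsAtInfinity (k A : Type*) [Field k] [CommRing A] [IsDomain A] [Algebra k A] :
    Set (ValuationSubring (FractionRing A)) :=
  {V | (∀ r : k, algebraMap k (FractionRing A) r ∈ V) ∧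
    ¬ ∀ f : A, algebraMap A (FractionRing A) f ∈ V}

/-- The `k`-rational points at infinity: the residue field of the valuation ring is `k`, that is,
every element of `V` is congruent to an element of `k` modulo the maximal ideal of `V`. -/
def rationalPointsAtInfinity (k A : Type*) [Field k] [CommRing A] [IsDomain A] [Algebra k A] :
    Set (ValuationSubring (FractionRing A)) :=
  {V | V ∈ pointsAtInfinity k A ∧
    ∀ v ∈ V, ∃ r : k, v - algebraMap k (FractionRing A) r ∈ V.nonunits}

end

/-!
Completing the square, `y = x + b / 2`, turns `x² + b x + c` into `y² + d` with
`4 d = -(b² - 4c - 2b)`, a nonconstant polynomial in `t`. Preimages are then iterated square roots: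
`y_{N+1} = ± √(y_N - d)`, starting from `y_1 = ± √((b² - 4c + 4a) / 4)`. Put
`m = deg (b² - 4c + 4a)` and `δ = deg d`. Over the Laurent series in a fractional power of `1 / t`,
`deg y_N ≤ max (m / 2 ^ N, δ / 2)` (`two_pow_mul_order_ge`), so that `deg y_N < δ` as soon as
`m < 2 ^ N`. From then on `y_N - d` has the leading term of `-d`, and its square root needs only a
square root of the leading coefficient of `-d` and no further ramification
(`isSquare_of_isRoot_preimagePoly`). Hence a single finite extension `K'` of `K` and a single power
of two `e ≤ 2 * (1 + m)` suffice for all `N`: every polynomial `φ_t^N(x) - a(t)` splits over `K'((s))`,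
where `t = s ^ (-e)` (`exists_forall_splits_preimagePoly`).

Since the equation is monic in `x`, a component is the zero set of a monic irreducible factor. Its
coefficients are polynomials in `t` which lie in `K'((s))`, hence have coefficients in `K'`
(`exists_monic_map_eq_of_dvd`). Each of its roots in `K'((s))` embeds the function field into
`K'((s))`, and the power series ring `K'[[s]]` induces a valuation ring with residue field `K'`
which does not contain `t`: a rational point at infinity. As `K'((s))` has degree at most `e` over
`K'((1 / t))`, the roots inducing a given valuation ring are roots of one polynomial over
`K'((1 / t))` of degree at most `e` (`exists_separating_polynomial`), and there are at most `e` of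
them (`exists_rationalPointsAtInfinity`).
-/

open scoped LaurentSeries

/-! ### Laurent series -/

/-- A Laurent series of even order whose leading coefficient is a square is itself a square. -/
theorem LaurentSeries.isSquare_of_order_even {E : Type*} [Field E] [CharZero E] {f : E⸨X⸩} (r : ℤ)
    (hr : f.order = r + r) (hc : IsSquare f.leadingCoeff) : IsSquare f := by
  rcases eq_or_ne f 0 with rfl | hf
  · exact ⟨0, by simp⟩
  obtain ⟨u, hu⟩ := hc
  have hlc : f.leadingCoeff ≠ 0 := HahnSeries.leadingCoeff_ne_zero.mpr hf
  set c := f.leadingCoeff with hcdef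
  set p := f.powerSeriesPart with hp
  have hpc : PowerSeries.constantCoeff p = c := by
    rw [← PowerSeries.coeff_zero_eq_constantCoeff_apply, hp, LaurentSeries.powerSeriesPart_coeff]
    simp [hcdef, HahnSeries.leadingCoeff_eq]
  set h : PowerSeries E := PowerSeries.C c⁻¹ * p - 1 with hh
  have hsub : PowerSeries.HasSubst h := by
    apply PowerSeries.HasSubst.of_constantCoeff_zero'
    simp [hh, hpc, hlc]
  -- `(1 + X) ^ (1 / 2)`, as a binomial series
  have hbin : (PowerSeries.binomialSeries E (1 / 2 : ℚ)) * PowerSeries.binomialSeries E (1 / 2 : ℚ)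
      = 1 + PowerSeries.X := by
    rw [← PowerSeries.binomialSeries_add]
    have := PowerSeries.binomialSeries_nat (R := ℚ) (A := E) 1
    norm_num at this ⊢
    exact this
  set w : PowerSeries E := (PowerSeries.binomialSeries E (1 / 2 : ℚ)).subst h with hw
  have hww : w * w = 1 + h := by
    rw [hw, ← PowerSeries.subst_mul hsub, hbin, PowerSeries.subst_add hsub,
      PowerSeries.subst_X hsub]
    congr 1
    rw [← PowerSeries.coe_substAlgHom hsub, map_one]
  have hpp : p = PowerSeries.C u * w * (PowerSeries.C u * w) := by
    calc p = PowerSeries.C c * (1 + h) := by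
          rw [hh, add_sub_cancel, ← mul_assoc, ← map_mul, mul_inv_cancel₀ hlc, map_one, one_mul]
      _ = _ := by rw [← hww, hu, map_mul]; ring
  refine ⟨HahnSeries.single r 1 * HahnSeries.ofPowerSeries ℤ E (PowerSeries.C u * w), ?_⟩
  conv_lhs => rw [← LaurentSeries.single_order_mul_powerSeriesPart f, ← hp, hpp, hr, map_mul]
  rw [mul_mul_mul_comm, HahnSeries.single_mul_single, mul_one]

/-- The ring homomorphism between fields of Laurent series given by a homomorphism of the
coefficient fields. -/
noncomputable def LaurentSeries.coeffMap {E E' : Type*} [Field E] [Field E'] (σ : E →+* E') :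
    E⸨X⸩ →+* E'⸨X⸩ where
  toFun f := f.map σ
  map_zero' := by ext; simp
  map_one' := by
    ext n
    by_cases h : n = 0 <;> simp [HahnSeries.coeff_one, h]
  map_add' f g := by ext; simp
  map_mul' f g := by
    ext n
    have hs : ∀ f : E⸨X⸩, (f.map σ).support = f.support := fun f ↦ by
      ext m; simp
    simp [HahnSeries.coeff_mul, hs]

theorem LaurentSeries.coeff_coeffMap {E E' : Type*} [Field E] [Field E'] (σ : E →+* E')
    (f : E⸨X⸩) (n : ℤ) : (LaurentSeries.coeffMap σ f).coeff n = σ (f.coeff n) := rfl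

theorem LaurentSeries.coeffMap_single {E E' : Type*} [Field E] [Field E'] (σ : E →+* E')
    (n : ℤ) (r : E) : LaurentSeries.coeffMap σ (HahnSeries.single n r) =
      HahnSeries.single n (σ r) := by
  ext m
  rw [LaurentSeries.coeff_coeffMap]
  by_cases h : m = n <;> simp [h]

theorem LaurentSeries.order_coeffMap {E E' : Type*} [Field E] [Field E'] (σ : E →+* E')
    {f : E⸨X⸩} (hf : f ≠ 0) : (LaurentSeries.coeffMap σ f).order = f.order := by
  apply le_antisymm
  · apply HahnSeries.order_le_of_coeff_ne_zero
    rw [LaurentSeries.coeff_coeffMap]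
    simpa [HahnSeries.leadingCoeff_eq] using HahnSeries.leadingCoeff_ne_zero.mpr hf
  · apply HahnSeries.order_le_of_coeff_ne_zero
    intro h
    have h2 : (LaurentSeries.coeffMap σ f).coeff (LaurentSeries.coeffMap σ f).order = 0 := by
      rw [LaurentSeries.coeff_coeffMap, h, map_zero]
    rw [← HahnSeries.leadingCoeff_eq, HahnSeries.leadingCoeff_eq_zero] at h2
    exact hf ((map_eq_zero _).mp h2)

/-- The substitution `s ↦ s ^ d` on Laurent series in `s`. -/
noncomputable def LaurentSeries.dilate (E : Type*) [Field E] (d : ℕ) [NeZero d] : E⸨X⸩ →+* E⸨X⸩ :=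
  HahnSeries.embDomainRingHom (AddMonoidHom.mulLeft (d : ℤ))
    (fun _ _ h ↦ mul_left_cancel₀ (Nat.cast_ne_zero.mpr (NeZero.ne d)) h)
    (fun _ _ ↦ mul_le_mul_iff_right₀ (Nat.cast_pos.mpr (NeZero.pos d)))

theorem LaurentSeries.coeff_dilate_mul {E : Type*} [Field E] (d : ℕ) [NeZero d] (f : E⸨X⸩) (n : ℤ) :
    (LaurentSeries.dilate E d f).coeff (d * n) = f.coeff n := by
  exact HahnSeries.embDomain_coeff (x := f) (a := n)

theorem LaurentSeries.coeff_dilate_of_not_dvd {E : Type*} [Field E] (d : ℕ) [NeZero d] (f : E⸨X⸩)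
    {n : ℤ} (hn : ¬ (d : ℤ) ∣ n) : (LaurentSeries.dilate E d f).coeff n = 0 := by
  refine HahnSeries.embDomain_of_notMem_range (x := f) ?_
  rintro ⟨m, hm⟩
  exact hn ⟨m, hm.symm⟩

theorem LaurentSeries.dilate_single {E : Type*} [Field E] (d : ℕ) [NeZero d] (n : ℤ) (r : E) :
    LaurentSeries.dilate E d (HahnSeries.single n r) = HahnSeries.single (d * n) r :=
  HahnSeries.embDomain_single

theorem LaurentSeries.order_dilate {E : Type*} [Field E] (d : ℕ) [NeZero d] {f : E⸨X⸩}
    (hf : f ≠ 0) : (LaurentSeries.dilate E d f).order = d * f.order := by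
  have h2 : LaurentSeries.dilate E d f ≠ 0 := (_root_.map_ne_zero _).mpr hf
  have h3 : (LaurentSeries.dilate E d f).orderTop = WithTop.map ((d : ℤ) * ·) f.orderTop :=
    HahnSeries.orderTop_embDomain (x := f)
  rw [← HahnSeries.order_eq_orderTop_of_ne_zero hf,
    ← HahnSeries.order_eq_orderTop_of_ne_zero h2] at h3
  exact WithTop.coe_injective h3

theorem LaurentSeries.orderTop_nonneg_iff {E : Type*} [Field E] {f : E⸨X⸩} :
    0 ≤ f.orderTop ↔ ∀ n < 0, f.coeff n = 0 := by
  rw [HahnSeries.le_orderTop_iff_forall]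
  constructor
  · intro h n hn
    exact h n (by exact_mod_cast hn)
  · intro h n hn
    exact h n (by exact_mod_cast hn)

theorem LaurentSeries.dilate_orderTop_nonneg {E : Type*} [Field E] (d : ℕ) [NeZero d] {f : E⸨X⸩}
    (hf : 0 ≤ f.orderTop) : 0 ≤ (LaurentSeries.dilate E d f).orderTop := by
  rcases eq_or_ne f 0 with rfl | h0
  · simp
  rw [HahnSeries.zero_le_orderTop_iff] at hf ⊢
  rw [LaurentSeries.order_dilate d h0]
  positivity

/-- The field of Laurent series in `s` has degree at most `d` over the subfield of Laurent series
in `s ^ d`: it is spanned by `1, s, …, s ^ (d - 1)`. -/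
theorem LaurentSeries.span_range_dilate (E : Type*) [Field E] (d : ℕ) [NeZero d] :
    Submodule.span (LaurentSeries.dilate E d).fieldRange
      (Set.range fun i : Fin d ↦ (HahnSeries.single (i : ℤ) 1 : E⸨X⸩)) = ⊤ := by
  rw [eq_top_iff]
  intro f _
  have hd : (0 : ℤ) < d := by exact_mod_cast Nat.pos_of_ne_zero (NeZero.ne d)
  -- the part of `f` supported on exponents congruent to `i`
  let g (i : Fin d) : E⸨X⸩ := HahnSeries.ofSuppBddBelow (fun n ↦ f.coeff (d * n + i)) (by
    refine ⟨-|f.order| - 1, fun n hn ↦ ?_⟩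
    have h1 : f.order ≤ d * n + i := HahnSeries.order_le_of_coeff_ne_zero hn
    have h2 : (i : ℤ) < d := by exact_mod_cast i.2
    have h3 := neg_abs_le f.order
    by_contra hlt
    push Not at hlt
    have h4 : (d : ℤ) * (n + 1) ≤ n + 1 := by nlinarith [abs_nonneg f.order]
    nlinarith)
  have hf : f = ∑ i : Fin d,
      (⟨LaurentSeries.dilate E d (g i), g i, rfl⟩ : (LaurentSeries.dilate E d).fieldRange) •
        (HahnSeries.single (i : ℤ) 1 : E⸨X⸩) := by
    ext n
    rw [HahnSeries.coeff_sum]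
    let j : Fin d := ⟨(n % d).toNat, by
      have := Int.emod_lt_of_pos n hd
      have := Int.emod_nonneg n hd.ne'
      omega⟩
    have hj : (j : ℤ) = n % d := Int.toNat_of_nonneg (Int.emod_nonneg n hd.ne')
    have hcoe : ∀ i : Fin d,
        ((⟨LaurentSeries.dilate E d (g i), g i, rfl⟩ : (LaurentSeries.dilate E d).fieldRange) •
          (HahnSeries.single (i : ℤ) 1 : E⸨X⸩)).coeff n =
        (LaurentSeries.dilate E d (g i)).coeff (n - i) := by
      intro i
      rw [Subfield.smul_def, smul_eq_mul]
      have := HahnSeries.coeff_mul_single_add (x := LaurentSeries.dilate E d (g i)) (r := 1)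
        (a := n - i) (b := (i : ℤ))
      simpa using this
    simp_rw [hcoe]
    rw [Finset.sum_eq_single j]
    · have h1 : n - (j : ℤ) = d * (n / d) := by
        rw [hj]
        have := Int.emod_add_mul_ediv n d
        linarith
      rw [h1, LaurentSeries.coeff_dilate_mul]
      change f.coeff n = f.coeff (d * (n / d) + j)
      congr 1
      linarith
    · intro i _ hij
      apply LaurentSeries.coeff_dilate_of_not_dvd
      intro hdvd
      apply hij
      have h1 : n % d = i % d := Int.emod_eq_emod_iff_emod_sub_eq_zero.mpr
        (Int.emod_eq_zero_of_dvd hdvd)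
      have h2 : (i : ℤ) % d = i := Int.emod_eq_of_lt (by positivity) (by exact_mod_cast i.2)
      apply Fin.ext
      have : (i : ℤ) = j := by rw [hj, h1, h2]
      exact_mod_cast this
    · simp
  rw [hf]
  exact Submodule.sum_mem _ fun i _ ↦ Submodule.smul_mem _ _ (Submodule.subset_span ⟨i, rfl⟩)

/-- Every Laurent series in `s` is a root of a monic polynomial of degree at most `d` whose
coefficients are Laurent series in `s ^ d`. -/
theorem LaurentSeries.exists_monic_dilate_root {E : Type*} [Field E] (d : ℕ) [NeZero d]
    (y : E⸨X⸩) : ∃ Q : E⸨X⸩[X], Q.Monic ∧ Q.natDegree ≤ d ∧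
      (Q.map (LaurentSeries.dilate E d)).eval y = 0 := by
  have hspan := LaurentSeries.span_range_dilate E d
  have hfin : Module.Finite (LaurentSeries.dilate E d).fieldRange E⸨X⸩ :=
    ⟨⟨(Set.finite_range _).toFinset, by rw [Set.Finite.coe_toFinset]; exact hspan⟩⟩
  have hrank : Module.finrank (LaurentSeries.dilate E d).fieldRange E⸨X⸩ ≤ d := by
    simpa using finrank_le_of_span_eq_top hspan
  have hint : IsIntegral (LaurentSeries.dilate E d).fieldRange y := Algebra.IsIntegral.isIntegral y
  let τ := RingEquiv.ofBijective (LaurentSeries.dilate E d).rangeRestrictField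
    (LaurentSeries.dilate E d).rangeRestrictField_bijective
  refine ⟨(minpoly (LaurentSeries.dilate E d).fieldRange y).map τ.symm.toRingHom,
    (minpoly.monic hint).map _, ?_, ?_⟩
  · rw [natDegree_map]
    exact (minpoly.natDegree_le y).trans hrank
  · rw [Polynomial.map_map]
    have : (LaurentSeries.dilate E d).comp τ.symm.toRingHom =
        algebraMap (LaurentSeries.dilate E d).fieldRange E⸨X⸩ := by
      ext1 z
      have := τ.apply_symm_apply z
      exact congrArg Subtype.val this
    rw [this, eval_map_algebraMap, minpoly.aeval]

/-! ### Expansion of polynomials at infinity -/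

/-- The expansion at `t = ∞` of a polynomial in `t`, with respect to the parameter `s` with
`t = s ^ (-e)`; the coefficients are mapped to `E` by `σ`. -/
noncomputable def expandAtInfty {k E : Type*} [Field k] [Field E] (σ : k →+* E) (e : ℕ) :
    k[X] →+* E⸨X⸩ :=
  eval₂RingHom (HahnSeries.C.comp σ) (HahnSeries.single (-(e : ℤ)) 1)

section expandAtInfty

variable {k E E' : Type*} [Field k] [Field E] [Field E'] (σ : k →+* E) (e : ℕ)

theorem expandAtInfty_C (r : k) : expandAtInfty σ e (C r) = HahnSeries.single 0 (σ r) := by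
  simp [expandAtInfty, HahnSeries.C_apply]

theorem expandAtInfty_X : expandAtInfty σ e X = HahnSeries.single (-(e : ℤ)) 1 := by
  simp [expandAtInfty]

theorem coeffMap_comp_expandAtInfty (τ : E →+* E') :
    (LaurentSeries.coeffMap τ).comp (expandAtInfty σ e) = expandAtInfty (τ.comp σ) e := by
  ext r
  all_goals simp [expandAtInfty_C, expandAtInfty_X, LaurentSeries.coeffMap_single]

theorem dilate_comp_expandAtInfty (d : ℕ) [NeZero d] :
    (LaurentSeries.dilate E d).comp (expandAtInfty σ e) = expandAtInfty σ (d * e) := by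
  ext r
  all_goals simp [expandAtInfty_C, expandAtInfty_X, LaurentSeries.dilate_single]

theorem expandAtInfty_comp_map (τ : E →+* E') :
    (expandAtInfty τ e).comp (mapRingHom σ) = expandAtInfty (τ.comp σ) e := by
  ext r
  all_goals simp [expandAtInfty_C, expandAtInfty_X]

theorem expandAtInfty_monomial (n : ℕ) (r : k) :
    expandAtInfty σ e (monomial n r) = HahnSeries.single (-((e : ℤ) * n)) (σ r) := by
  rw [← C_mul_X_pow_eq_monomial, map_mul, map_pow, expandAtInfty_C, expandAtInfty_X,
    HahnSeries.single_pow, HahnSeries.single_mul_single]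
  simp [mul_comm]

theorem coeff_expandAtInfty [NeZero e] (p : k[X]) (n : ℕ) :
    (expandAtInfty σ e p).coeff (-((e : ℤ) * n)) = σ (p.coeff n) := by
  induction p using Polynomial.induction_on' with
  | add p q hp hq => simp [hp, hq]
  | monomial m r =>
    rw [expandAtInfty_monomial, coeff_monomial, HahnSeries.coeff_single]
    by_cases h : m = n
    · simp [h]
    · have h' : n ≠ m := fun h' ↦ h h'.symm
      simp [h, h', NeZero.ne e]

theorem coeff_expandAtInfty_eq_zero [NeZero e] (p : k[X]) {z : ℤ}
    (h : ∀ n : ℕ, n ≤ p.natDegree → z ≠ -((e : ℤ) * n)) : (expandAtInfty σ e p).coeff z = 0 := by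
  rw [p.as_sum_range, map_sum, HahnSeries.coeff_sum]
  refine Finset.sum_eq_zero fun n hn ↦ ?_
  rw [expandAtInfty_monomial]
  exact HahnSeries.coeff_single_of_ne (h n (by simpa [Nat.lt_succ_iff] using hn))

theorem expandAtInfty_injective [NeZero e] : Function.Injective (expandAtInfty σ e) := by
  intro p q h
  ext n
  apply σ.injective
  rw [← coeff_expandAtInfty σ e p, ← coeff_expandAtInfty σ e q, h]

theorem order_expandAtInfty [NeZero e] {p : k[X]} (hp : p ≠ 0) :
    (expandAtInfty σ e p).order = -((e : ℤ) * p.natDegree) := by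
  have hne : expandAtInfty σ e p ≠ 0 :=
    fun h ↦ hp (expandAtInfty_injective σ e (by rw [h, map_zero]))
  apply le_antisymm
  · apply HahnSeries.order_le_of_coeff_ne_zero
    rw [coeff_expandAtInfty]
    simpa using hp
  · by_contra hlt
    push Not at hlt
    have h0 : (expandAtInfty σ e p).coeff (expandAtInfty σ e p).order ≠ 0 := by
      rw [← HahnSeries.leadingCoeff_eq]
      exact HahnSeries.leadingCoeff_ne_zero.mpr hne
    refine h0 (coeff_expandAtInfty_eq_zero σ e p fun n hn h ↦ ?_)
    rw [h] at hlt
    have : (e : ℤ) * n ≤ e * p.natDegree := by gcongr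
    linarith

theorem leadingCoeff_expandAtInfty [NeZero e] (p : k[X]) :
    (expandAtInfty σ e p).leadingCoeff = σ p.leadingCoeff := by
  rcases eq_or_ne p 0 with rfl | hp
  · simp
  rw [HahnSeries.leadingCoeff_eq, order_expandAtInfty σ e hp, coeff_expandAtInfty,
    Polynomial.leadingCoeff]

/-- Every Laurent series in `s ^ e = 1 / t` is the sum of a polynomial in `t` and a power series
in `s`. -/
theorem exists_expandAtInfty_sub_nonneg [NeZero e] (g : k⸨X⸩) :
    ∃ p : k[X], 0 ≤ (LaurentSeries.dilate k e g - expandAtInfty (RingHom.id k) e p).orderTop := by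
  have key : ∃ p : k[X], 0 ≤ (g - expandAtInfty (RingHom.id k) 1 p).orderTop := by
    refine ⟨∑ n ∈ Finset.range (g.order.natAbs + 1), monomial n (g.coeff (-n)), ?_⟩
    rw [LaurentSeries.orderTop_nonneg_iff]
    intro z hz
    obtain ⟨n, rfl⟩ : ∃ n : ℕ, z = -n := ⟨z.natAbs, by omega⟩
    have h1 := coeff_expandAtInfty (RingHom.id k) 1
      (∑ n ∈ Finset.range (g.order.natAbs + 1), monomial n (g.coeff (-n))) n
    simp only [Nat.cast_one, one_mul] at h1
    rw [HahnSeries.coeff_sub, h1]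
    by_cases hn : n < g.order.natAbs + 1
    · simp [coeff_monomial, hn]
    · have : g.coeff (-n) = 0 := HahnSeries.coeff_eq_zero_of_lt_order (by omega)
      simp [coeff_monomial, this]
  obtain ⟨p, hp⟩ := key
  refine ⟨p, ?_⟩
  have := LaurentSeries.dilate_orderTop_nonneg e hp
  rw [map_sub, ← RingHom.comp_apply, dilate_comp_expandAtInfty, mul_one] at this
  exact this

end expandAtInfty

/-! ### Points at infinity from Laurent series roots -/

/-- The ring of power series, as a valuation subring of the field of Laurent series. -/
noncomputable def laurentIntegers (E : Type*) [Field E] : ValuationSubring E⸨X⸩ where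
  carrier := {f | 0 ≤ f.orderTop}
  mul_mem' {f g} hf hg := by
    simp only [Set.mem_ofPred_eq, HahnSeries.orderTop_mul] at *
    exact add_nonneg hf hg
  one_mem' := by simp
  add_mem' {f g} hf hg := by
    simp only [Set.mem_ofPred_eq] at *
    exact (le_min hf hg).trans HahnSeries.min_orderTop_le_orderTop_add
  zero_mem' := by simp
  neg_mem' {f} hf := by simpa using hf
  mem_or_inv_mem' f := by
    rcases eq_or_ne f 0 with rfl | hf
    · simp
    have h : f.order + f⁻¹.order = 0 := by
      rw [← HahnSeries.order_mul hf (inv_ne_zero hf), mul_inv_cancel₀ hf, HahnSeries.order_one]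
    change 0 ≤ f.orderTop ∨ 0 ≤ f⁻¹.orderTop
    rw [HahnSeries.zero_le_orderTop_iff, HahnSeries.zero_le_orderTop_iff]
    omega

section laurentIntegers

variable {E : Type*} [Field E]

theorem mem_laurentIntegers {f : E⸨X⸩} : f ∈ laurentIntegers E ↔ 0 ≤ f.orderTop := by
  change f ∈ {f : E⸨X⸩ | 0 ≤ f.orderTop} ↔ _
  simp only [Set.mem_ofPred_eq]

theorem mem_laurentIntegers_iff_order {f : E⸨X⸩} : f ∈ laurentIntegers E ↔ 0 ≤ f.order :=
  mem_laurentIntegers.trans HahnSeries.zero_le_orderTop_iff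

theorem single_mem_laurentIntegers {n : ℤ} (hn : 0 ≤ n) (r : E) :
    HahnSeries.single n r ∈ laurentIntegers E := by
  rcases eq_or_ne r 0 with rfl | hr
  · simp
  rwa [mem_laurentIntegers_iff_order, HahnSeries.order_single hr]

theorem sub_constantCoeff_mem_nonunits {f : E⸨X⸩} (hf : f ∈ laurentIntegers E) :
    f - HahnSeries.single 0 (f.coeff 0) ∈ (laurentIntegers E).nonunits := by
  set g := f - HahnSeries.single 0 (f.coeff 0) with hg
  rw [ValuationSubring.mem_nonunits_iff_or]
  by_contra! hcon
  obtain ⟨h0, hinv⟩ := hcon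
  have hgmem : g ∈ laurentIntegers E :=
    sub_mem hf (single_mem_laurentIntegers le_rfl _)
  have h : g.orderTop + g⁻¹.orderTop = 0 := by
    rw [← HahnSeries.orderTop_mul, mul_inv_cancel₀ h0, HahnSeries.orderTop_one]
  have h1 : g.orderTop = 0 := by
    refine le_antisymm ?_ (mem_laurentIntegers.mp hgmem)
    rw [← h]
    exact le_add_of_nonneg_right (mem_laurentIntegers.mp hinv)
  exact HahnSeries.coeff_orderTop_ne (g := 0) h1 (by simp [hg])

/-- Finitely many Laurent series become integral after multiplication by a power of `s ^ e`. -/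
theorem exists_single_mul_mem_laurentIntegers (e : ℕ) [NeZero e] (T : Finset E⸨X⸩) :
    ∃ c : ℕ, ∀ f ∈ T, HahnSeries.single ((e : ℤ) * c) 1 * f ∈ laurentIntegers E := by
  refine ⟨∑ f ∈ T, f.order.natAbs, fun f hf ↦ ?_⟩
  rcases eq_or_ne f 0 with rfl | h0
  · simp
  rw [mem_laurentIntegers_iff_order, HahnSeries.order_mul (by simp) h0,
    HahnSeries.order_single one_ne_zero]
  have h1 : f.order.natAbs ≤ ∑ f ∈ T, f.order.natAbs :=
    Finset.single_le_sum (f := fun f : E⸨X⸩ ↦ f.order.natAbs) (fun _ _ ↦ Nat.zero_le _) hf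
  have h2 : (∑ f ∈ T, f.order.natAbs) ≤ e * ∑ f ∈ T, f.order.natAbs :=
    Nat.le_mul_of_pos_left _ (NeZero.pos e)
  zify at h1 h2
  have := neg_abs_le f.order
  push_cast
  linarith

end laurentIntegers

/-- If a polynomial `Q` with coefficients in `k((s ^ e)) = k((1 / t))` vanishes at `y₀` but not at
`y`, then the valuation rings on `k(t)[x]` induced by `x ↦ y₀` and `x ↦ y` are different: a
polynomial `H` over `k[t]` close to a multiple of `Q` takes a small value at `y₀` and a large one at
`y`. -/
theorem exists_separating_polynomial {k : Type*} [Field k] (e : ℕ) [NeZero e] {y₀ y : k⸨X⸩}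
    {Q : k⸨X⸩[X]} (h₀ : (Q.map (LaurentSeries.dilate k e)).eval y₀ = 0)
    (h : (Q.map (LaurentSeries.dilate k e)).eval y ≠ 0) :
    ∃ (H : k[X][X]) (c : ℕ),
      HahnSeries.single ((e : ℤ) * c) 1 * H.eval₂ (expandAtInfty (RingHom.id k) e) y₀ ∈
        laurentIntegers k ∧
      HahnSeries.single ((e : ℤ) * c) 1 * H.eval₂ (expandAtInfty (RingHom.id k) e) y ∉
        laurentIntegers k := by
  classical
  set n := Q.natDegree + 1 with hn
  set D := LaurentSeries.dilate k e
  obtain ⟨c, hc⟩ := exists_single_mul_mem_laurentIntegers e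
    ((Finset.range n).image (y₀ ^ ·) ∪ (Finset.range n).image (y ^ ·))
  set z := (Q.map D).eval y with hz
  -- the factor `t ^ w` makes the value of `Q` at `y` large compared to the error terms
  set w : ℕ := c + z.order.natAbs + 1 with hw
  -- the polynomial parts in `t` of the coefficients of `t ^ w * Q`
  choose p hp using fun i ↦ exists_expandAtInfty_sub_nonneg (k := k) e
    (HahnSeries.single (-(w : ℤ)) 1 * Q.coeff i)
  set H : k[X][X] := ∑ i ∈ Finset.range n, monomial i (p i) with hH
  have heval : ∀ x : k⸨X⸩,
      (∀ i < n, HahnSeries.single ((e : ℤ) * c) 1 * x ^ i ∈ laurentIntegers k) →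
      HahnSeries.single ((e : ℤ) * c) 1 *
          (HahnSeries.single (-((e : ℤ) * w)) 1 * (Q.map D).eval x) -
        HahnSeries.single ((e : ℤ) * c) 1 * H.eval₂ (expandAtInfty (RingHom.id k) e) x ∈
          laurentIntegers k := by
    intro x hx
    have h1 : (Q.map D).eval x = ∑ i ∈ Finset.range n, D (Q.coeff i) * x ^ i := by
      rw [eval_map, eval₂_eq_sum_range]
    have h2 : H.eval₂ (expandAtInfty (RingHom.id k) e) x =
        ∑ i ∈ Finset.range n, expandAtInfty (RingHom.id k) e (p i) * x ^ i := by
      rw [hH, eval₂_finsetSum]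
      exact Finset.sum_congr rfl fun i _ ↦ eval₂_monomial _ _
    rw [h1, h2, ← mul_sub, Finset.mul_sum, ← Finset.sum_sub_distrib, Finset.mul_sum]
    refine sum_mem fun i hi ↦ ?_
    have h3 := (laurentIntegers k).mul_mem _ _ (mem_laurentIntegers.mpr (hp i))
      (hx i (Finset.mem_range.mp hi))
    rw [map_mul, LaurentSeries.dilate_single, mul_neg] at h3
    convert h3 using 1
    ring
  refine ⟨H, c, ?_, fun hcon ↦ ?_⟩
  · have := heval y₀ fun i hi ↦ hc _ (Finset.mem_union_left _
      (Finset.mem_image_of_mem _ (Finset.mem_range.mpr hi)))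
    rw [h₀, mul_zero, mul_zero, zero_sub] at this
    simpa using neg_mem this
  · have h1 := add_mem (heval y fun i hi ↦ hc _ (Finset.mem_union_right _
      (Finset.mem_image_of_mem _ (Finset.mem_range.mpr hi)))) hcon
    rw [sub_add_cancel, ← hz, mem_laurentIntegers_iff_order,
      HahnSeries.order_mul (by simp) (mul_ne_zero (by simp) h), HahnSeries.order_mul (by simp) h,
      HahnSeries.order_single one_ne_zero, HahnSeries.order_single one_ne_zero] at h1
    have h2 : (e : ℤ) * w = e * c + e * (z.order.natAbs + 1) := by
      rw [hw]
      push_cast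
      ring
    have h3 : ((z.order.natAbs + 1 : ℕ) : ℤ) ≤ (e * (z.order.natAbs + 1) : ℕ) := by
      exact_mod_cast Nat.le_mul_of_pos_left _ (NeZero.pos e)
    push_cast at h3
    have := le_abs_self z.order
    push_cast at h2
    linarith

theorem ker_eval₂RingHom_eq_span {R S : Type*} [CommRing R] [IsDomain R] [IsIntegrallyClosed R]
    [CommRing S] [IsDomain S] {φ : R →+* S} (hφ : Function.Injective φ) {G : R[X]} (hG : G.Monic)
    (hp : Prime G) {y : S} (hy : G.eval₂ φ y = 0) :
    RingHom.ker (eval₂RingHom φ y) = Ideal.span {G} := by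
  algebraize [φ]
  have htf : Module.IsTorsionFree R S := Module.isTorsionFree_iff_algebraMap_injective.mpr hφ
  have hint : IsIntegral R y := ⟨G, hG, hy⟩
  have hdvd : minpoly R y ∣ G := minpoly.isIntegrallyClosed_dvd hint hy
  have hass : Associated (minpoly R y) G :=
    (minpoly.irreducible hint).associated_of_dvd hp.irreducible hdvd
  rw [← eq_of_monic_of_associated (minpoly.monic hint) hG hass, ← minpoly.ker_eval hint]
  rfl

/-- Let `A = k[t][x] / (G)` be the coordinate ring of an integral curve with `G` monic in `x`, such
that `G` splits over `k((s))`, where `t = s ^ (-e)`. Every root gives a `k`-rational point at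
infinity, and each point arises from at most `e` roots, so that there are at least `deg G / e` of
them. -/
theorem exists_rationalPointsAtInfinity {k A : Type*} [Field k] [CharZero k] [CommRing A]
    [IsDomain A] [Algebra k A] (e : ℕ) [NeZero e] {G : k[X][X]} (hG : G.Monic)
    {q : k[X][X] →+* A} (hq : Function.Surjective q) (hker : RingHom.ker q = Ideal.span {G})
    (hqk : ∀ r, q (C (C r)) = algebraMap k A r)
    (hs : (G.map (expandAtInfty (RingHom.id k) e)).Splits) :
    ∃ S : Finset (ValuationSubring (FractionRing A)),
      (∀ V ∈ S, V ∈ rationalPointsAtInfinity k A) ∧ G.natDegree ≤ e * S.card := by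
  classical
  set φ := expandAtInfty (RingHom.id k) e with hφ
  have hinj : Function.Injective φ := expandAtInfty_injective _ _
  have hprime : Prime G := by
    rw [← Ideal.span_singleton_prime hG.ne_zero, ← hker]
    exact RingHom.ker_isPrime q
  have hcard : (G.map φ).roots.toFinset.card = G.natDegree := by
    have hirr := (hG.irreducible_iff_irreducible_map_fraction_map
      (K := FractionRing k[X])).mp hprime.irreducible
    have hsep : (G.map φ).Separable := by
      have := hirr.separable.map (f := IsFractionRing.lift (K := FractionRing k[X]) hinj)
      rw [Polynomial.map_map] at this
      have hcomp : (IsFractionRing.lift (K := FractionRing k[X]) hinj).comp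
          (algebraMap k[X] (FractionRing k[X])) = φ := RingHom.ext fun x ↦ by simp
      rwa [hcomp] at this
    rw [Multiset.toFinset_card_of_nodup (nodup_roots hsep), ← hs.natDegree_eq_card_roots,
      hG.natDegree_map]
  obtain ⟨π, hπ⟩ : ∃ π : k[X][X] →+* FractionRing A, ∀ H, π H = algebraMap A _ (q H) :=
    ⟨(algebraMap A (FractionRing A)).comp q, fun _ ↦ rfl⟩
  have hφC : ∀ r, φ (C r) = HahnSeries.single 0 r := fun r ↦ expandAtInfty_C _ _ _
  have hφX : φ X = HahnSeries.single (-(e : ℤ)) 1 := expandAtInfty_X _ _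
  have hι : ∀ y : (G.map φ).roots.toFinset, ∃ ι : FractionRing A →+* k⸨X⸩,
      ∀ H : k[X][X], ι (π H) = H.eval₂ φ y := by
    rintro ⟨y, hy⟩
    have hy0 : G.eval₂ φ y = 0 := by
      rw [Multiset.mem_toFinset, mem_roots (hG.map φ).ne_zero, IsRoot.def, eval_map] at hy
      exact hy
    have hker' := ker_eval₂RingHom_eq_span hinj hG hprime hy0
    let l : A →+* k⸨X⸩ := q.liftOfSurjective hq ⟨eval₂RingHom φ y, (hker.trans hker'.symm).le⟩
    have hl : ∀ H, l (q H) = H.eval₂ φ y := q.liftOfRightInverse_comp_apply _ _ _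
    have hlinj : Function.Injective l := by
      rw [injective_iff_map_eq_zero]
      intro z hz
      obtain ⟨H, rfl⟩ := hq z
      have : H ∈ RingHom.ker (eval₂RingHom φ y) := (hl H).symm.trans hz
      rwa [hker', ← hker] at this
    refine ⟨IsFractionRing.lift (K := FractionRing A) hlinj, fun H ↦ ?_⟩
    rw [hπ, IsFractionRing.lift_algebraMap, hl]
  choose ι hι using hι
  set V : (G.map φ).roots.toFinset → ValuationSubring (FractionRing A) :=
    fun y ↦ (laurentIntegers k).comap (ι y) with hV
  have hconst : ∀ y (r : k), ι y (algebraMap k (FractionRing A) r) =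
      HahnSeries.single 0 r := by
    intro y r
    have h1 : algebraMap k (FractionRing A) r = π (C (C r)) := by
      rw [IsScalarTower.algebraMap_apply k A, ← hqk, hπ]
    rw [h1, hι, eval₂_C, hφC]
  refine ⟨Finset.univ.image V, ?_, ?_⟩
  · intro W hW
    obtain ⟨y, -, rfl⟩ := Finset.mem_image.mp hW
    refine ⟨⟨fun r ↦ ?_, fun hall ↦ ?_⟩, fun v hv ↦ ⟨(ι y v).coeff 0, ?_⟩⟩
    · rw [hV, ValuationSubring.mem_comap, hconst]
      exact single_mem_laurentIntegers le_rfl r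
    · have h1 := hall (q (C X))
      rw [← hπ, hV, ValuationSubring.mem_comap, hι, eval₂_C, hφX,
        mem_laurentIntegers_iff_order, HahnSeries.order_single one_ne_zero] at h1
      have := NeZero.pos e
      omega
    · have h1 := sub_constantCoeff_mem_nonunits (ValuationSubring.mem_comap.mp hv)
      rw [← hconst y, ← map_sub, ValuationSubring.mem_nonunits_iff_or] at h1
      rw [ValuationSubring.mem_nonunits_iff_or]
      refine h1.imp (fun h ↦ (_root_.map_eq_zero _).mp h) fun h hmem ↦ h ?_
      rw [← map_inv₀]
      exact hmem
  · have hfib := Finset.card_le_mul_card_image (f := V) Finset.univ e (fun W hW ↦ ?_)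
    · rwa [Finset.card_univ, Fintype.card_coe, hcard] at hfib
    obtain ⟨y₀, -, rfl⟩ := Finset.mem_image.mp hW
    obtain ⟨Q, hQm, hQd, hQ0⟩ := LaurentSeries.exists_monic_dilate_root e (y₀ : k⸨X⸩)
    set q := Q.map (LaurentSeries.dilate k e)
    have hroot : ∀ y, V y = V y₀ → q.eval (y : k⸨X⸩) = 0 := by
      intro y hy
      by_contra hne
      obtain ⟨H, c, h1, h2⟩ := exists_separating_polynomial e hQ0 hne
      -- the element `H / t ^ c` of the function field
      set u : FractionRing A := π H / π (C (X ^ c)) with hu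
      have hιu : ∀ y, ι y u = HahnSeries.single ((e : ℤ) * c) 1 * H.eval₂ φ y := by
        intro y
        rw [hu, map_div₀, hι, hι, eval₂_C, map_pow, hφX, HahnSeries.single_pow,
          div_eq_inv_mul, HahnSeries.inv_single]
        simp [mul_comm]
      have h3 : u ∈ V y₀ := by
        rw [hV, ValuationSubring.mem_comap, hιu]
        exact h1
      rw [← hy, hV, ValuationSubring.mem_comap, hιu] at h3
      exact h2 h3
    calc (Finset.univ.filter fun y ↦ V y = V y₀).card
        ≤ q.roots.toFinset.card := by
          refine Finset.card_le_card_of_injOn (fun y ↦ (y : k⸨X⸩)) (fun y hy ↦ ?_)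
            Subtype.val_injective.injOn
          simp only [Finset.coe_filter, Set.mem_ofPred_eq] at hy
          simp only [Finset.mem_coe, Multiset.mem_toFinset]
          exact (mem_roots (hQm.map _).ne_zero).mpr (hroot y hy.2)
      _ ≤ q.roots.card := Multiset.toFinset_card_le _
      _ ≤ q.natDegree := card_roots' _
      _ ≤ e := by rwa [hQm.natDegree_map]

/-! ### Iterated preimages as Laurent series -/

theorem quadFamily_eq {K : Type*} [Field K] (b c : K[X]) :
    quadFamily b c = X ^ 2 + (C b * X + C c) := by
  rw [quadFamily, add_assoc]

theorem monic_quadFamily {K : Type*} [Field K] (b c : K[X]) : (quadFamily b c).Monic := by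
  rw [quadFamily_eq]
  exact monic_X_pow_add (degree_linear_lt)

theorem natDegree_quadFamily {K : Type*} [Field K] (b c : K[X]) :
    (quadFamily b c).natDegree = 2 := by
  rw [quadFamily_eq]
  exact natDegree_eq_of_degree_eq_some
    ((degree_add_eq_left_of_degree_lt (by rw [degree_X_pow]; exact degree_linear_lt)).trans
      (degree_X_pow 2))

theorem preimagePoly_zero {K : Type*} [Field K] (a b c : K[X]) :
    preimagePoly a b c 0 = X - C a := rfl

theorem preimagePoly_succ {K : Type*} [Field K] (a b c : K[X]) (N : ℕ) :
    preimagePoly a b c (N + 1) = (preimagePoly a b c N).comp (quadFamily b c) := by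
  have h : ∀ (N : ℕ) (p : K[X][X]), (quadFamily b c).comp^[N] p =
      ((quadFamily b c).comp^[N] X).comp p := by
    intro N
    induction N with
    | zero => simp
    | succ N ih =>
      intro p
      rw [Function.iterate_succ_apply', Function.iterate_succ_apply', ih p, comp_assoc]
  rw [preimagePoly, preimagePoly, Function.iterate_succ_apply, h, comp_X, sub_comp, C_comp]

theorem monic_preimagePoly {K : Type*} [Field K] (a b c : K[X]) (N : ℕ) :
    (preimagePoly a b c N).Monic := by
  induction N with
  | zero => exact monic_X_sub_C a
  | succ N ih =>
    rw [preimagePoly_succ]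
    exact ih.comp (monic_quadFamily b c) (by rw [natDegree_quadFamily]; norm_num)

theorem Polynomial.Splits.comp_of_forall_root {F : Type*} [Field F] {p q : F[X]} (hp : p.Splits)
    (hm : p.Monic) (h : ∀ z, p.eval z = 0 → (q - C z).Splits) : (p.comp q).Splits := by
  rw [hp.eq_prod_roots_of_monic hm, multiset_prod_comp, Multiset.map_map]
  refine Splits.multisetProd fun f hf ↦ ?_
  obtain ⟨z, hz, rfl⟩ := Multiset.mem_map.mp hf
  simpa using h z ((mem_roots hm.ne_zero).mp hz)

instance LaurentSeries.charZero {E : Type*} [Field E] [CharZero E] : CharZero E⸨X⸩ :=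
  charZero_of_injective_ringHom (f := (HahnSeries.C : E →+* E⸨X⸩)) HahnSeries.C_injective

section Splitting

variable {K E F : Type*} [Field K] [Field E] [CharZero E] [Field F] [CharZero F]

theorem eval₂_quadFamily_add {φ : K[X] →+* F} (b c : K[X]) (x : F) :
    (quadFamily b c).eval₂ φ x + (φ b ^ 2 / 4 - φ c) = (x + φ b / 2) ^ 2 := by
  simp only [quadFamily, eval₂_add, eval₂_pow, eval₂_X, eval₂_mul, eval₂_C]
  ring

/-- Extracting preimages under `x² + b x + c` amounts to extracting square roots. -/
theorem splits_quadFamily_sub {φ : K[X] →+* F} (b c : K[X]) {z : F}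
    (hz : IsSquare (z + (φ b ^ 2 / 4 - φ c))) : ((quadFamily b c).map φ - C z).Splits := by
  obtain ⟨u, hu⟩ := hz
  have hz' : z = u * u - (φ b ^ 2 / 4 - φ c) := by rw [← hu]; ring
  have : (quadFamily b c).map φ - C z = (X - C (u - φ b / 2)) * (X - C (-u - φ b / 2)) := by
    have h2 : (C (φ b) : F[X]) = C (φ b / 2) + C (φ b / 2) := by rw [← map_add, add_halves]
    have h4 : (C (φ b ^ 2 / 4) : F[X]) = C (φ b / 2) * C (φ b / 2) := by
      rw [← map_mul]
      congr 1
      ring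
    simp only [quadFamily, Polynomial.map_add, Polynomial.map_pow, map_X, Polynomial.map_mul,
      map_C, hz', map_sub, map_mul, map_neg, h4]
    rw [h2]
    ring
  rw [this]
  exact (Splits.X_sub_C _).mul (Splits.X_sub_C _)

theorem splits_preimagePoly_succ {φ : K[X] →+* F} (a b c : K[X]) {N : ℕ}
    (hs : ((preimagePoly a b c N).map φ).Splits)
    (h : ∀ z, (preimagePoly a b c N).eval₂ φ z = 0 → IsSquare (z + (φ b ^ 2 / 4 - φ c))) :
    ((preimagePoly a b c (N + 1)).map φ).Splits := by
  rw [preimagePoly_succ, Polynomial.map_comp]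
  refine hs.comp_of_forall_root ((monic_preimagePoly a b c N).map φ) fun z hz ↦ ?_
  rw [eval_map] at hz
  exact splits_quadFamily_sub b c (h z hz)

variable [CharZero K] (σ : K →+* E) (e : ℕ)

theorem expandAtInfty_div_four (p : K[X]) :
    expandAtInfty σ e p / 4 = expandAtInfty σ e (C 4⁻¹ * p) := by
  rw [div_eq_iff (OfNat.ofNat_ne_zero 4), ← map_ofNat (expandAtInfty σ e) 4, ← map_mul,
    ← map_ofNat (C : K →+* K[X]) 4, mul_right_comm, ← C_mul, inv_mul_cancel₀
    (OfNat.ofNat_ne_zero 4), C_1, one_mul]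

variable [NeZero e]

theorem order_expandAtInfty_div_four {p : K[X]} (hp : p ≠ 0) :
    (expandAtInfty σ e p / 4).order = -((e : ℤ) * p.natDegree) := by
  have h4 : (4⁻¹ : K) ≠ 0 := by norm_num
  rw [expandAtInfty_div_four, order_expandAtInfty σ e (mul_ne_zero (C_ne_zero.mpr h4) hp),
    natDegree_C_mul h4]

/-- Near `t = ∞`, an `N`-th preimage `x` of `a` satisfies
`deg (x + b / 2) ≤ max (m / 2 ^ N, δ / 2)`, where `m = deg (b² - 4c + 4a)` and
`δ = deg (b² - 4c - 2b)`; here in the form needed, for `x` with `deg (x + b / 2) ≥ δ`. -/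
theorem two_pow_mul_order_ge (a b c : K[X]) (hbc : 0 < (b ^ 2 - 4 * c - 2 * b).natDegree) {N : ℕ}
    {x : E⸨X⸩} (hx : (preimagePoly a b c (N + 1)).eval₂ (expandAtInfty σ e) x = 0)
    (hne : x + expandAtInfty σ e b / 2 ≠ 0)
    (hle : (x + expandAtInfty σ e b / 2).order ≤ -((e : ℤ) * (b ^ 2 - 4 * c - 2 * b).natDegree)) :
    -((e : ℤ) * (b ^ 2 - 4 * c + 4 * a).natDegree) ≤
      2 ^ (N + 1) * (x + expandAtInfty σ e b / 2).order := by
  set φ := expandAtInfty σ e with hφ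
  have he : (0 : ℤ) < e := by exact_mod_cast NeZero.pos e
  induction N generalizing x with
  | zero =>
    rw [preimagePoly_succ, preimagePoly_zero, eval₂_comp, eval₂_sub, eval₂_X, eval₂_C,
      sub_eq_zero] at hx
    have h := eval₂_quadFamily_add (φ := φ) b c x
    have h1 : φ a + (φ b ^ 2 / 4 - φ c) = φ (b ^ 2 - 4 * c + 4 * a) / 4 := by
      simp only [map_add, map_sub, map_mul, map_pow, map_ofNat]
      ring
    rw [hx, h1] at h
    have hne' : b ^ 2 - 4 * c + 4 * a ≠ 0 := by
      intro h0
      rw [h0, map_zero, zero_div] at h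
      exact hne (pow_eq_zero_iff two_ne_zero |>.mp h.symm)
    have h2 := congrArg HahnSeries.order h
    rw [order_expandAtInfty_div_four σ e hne', HahnSeries.order_pow] at h2
    simp at h2 ⊢
    exact h2.le
  | succ N ih =>
    -- `(x + b / 2)² = (y + b / 2) - d` with `y` an `N`-th preimage; as `deg (x + b / 2) ≥ δ`, the
    -- term `y + b / 2` has to dominate
    rw [preimagePoly_succ, eval₂_comp] at hx
    set y := (quadFamily b c).eval₂ φ x with hy
    have h := eval₂_quadFamily_add (φ := φ) b c x
    have h1 : y + (φ b ^ 2 / 4 - φ c) = (y + φ b / 2) + φ (b ^ 2 - 4 * c - 2 * b) / 4 := by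
      simp only [map_sub, map_mul, map_pow, map_ofNat]
      ring
    have hord : (φ (b ^ 2 - 4 * c - 2 * b) / 4).order =
        -((e : ℤ) * (b ^ 2 - 4 * c - 2 * b).natDegree) := by
      apply order_expandAtInfty_div_four
      rintro h0
      simp [h0] at hbc
    rw [← hy, h1] at h
    have h2 := congrArg HahnSeries.order h
    rw [HahnSeries.order_pow] at h2
    have hneg : -((e : ℤ) * (b ^ 2 - 4 * c - 2 * b).natDegree) < 0 := by
      have : (0 : ℤ) < e * (b ^ 2 - 4 * c - 2 * b).natDegree := by positivity
      linarith
    have hy0 : y + φ b / 2 ≠ 0 := by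
      intro h0
      rw [h0, zero_add, hord] at h2
      simp at h2
      linarith
    have h3 := HahnSeries.min_order_le_order_add (x := y + φ b / 2)
      (y := φ (b ^ 2 - 4 * c - 2 * b) / 4) (by rw [h]; exact pow_ne_zero 2 hne)
    rw [h2, hord] at h3
    simp only [nsmul_eq_mul, Nat.cast_ofNat] at h3
    have h4 : (y + φ b / 2).order ≤ 2 * (x + φ b / 2).order := by
      rcases min_le_iff.mp h3 with h3 | h3
      · exact h3
      · linarith
    have h5 := ih hx hy0 (by linarith)
    calc _ ≤ _ := h5
      _ ≤ 2 ^ (N + 1) * (2 * (x + φ b / 2).order) := by gcongr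
      _ = _ := by ring

/-- For `2 ^ N > deg (b² - 4c + 4a)`, the preimages of an `N`-th preimage `z` of `a` are Laurent
series over the same field, since the quantity under the square root has the leading term of
`(b² - 4c - 2b) / 4`. -/
theorem isSquare_of_isRoot_preimagePoly (a b c : K[X])
    (hbc : 0 < (b ^ 2 - 4 * c - 2 * b).natDegree) {N : ℕ}
    (hN : (b ^ 2 - 4 * c + 4 * a).natDegree < 2 ^ (N + 1)) (he : Even e)
    (hσ : IsSquare (σ (b ^ 2 - 4 * c - 2 * b).leadingCoeff)) {z : E⸨X⸩}
    (hz : (preimagePoly a b c (N + 1)).eval₂ (expandAtInfty σ e) z = 0) :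
    IsSquare (z + (expandAtInfty σ e b ^ 2 / 4 - expandAtInfty σ e c)) := by
  set φ := expandAtInfty σ e with hφ
  set p := b ^ 2 - 4 * c - 2 * b with hp
  have hp0 : p ≠ 0 := by
    rintro h0
    simp [h0] at hbc
  have h1 : z + (φ b ^ 2 / 4 - φ c) = (z + φ b / 2) + φ p / 4 := by
    simp only [hp, map_sub, map_mul, map_pow, map_ofNat]
    ring
  have hord : (φ p / 4).order = -((e : ℤ) * p.natDegree) := order_expandAtInfty_div_four σ e hp0
  have hφp : φ p / 4 ≠ 0 :=
    div_ne_zero (fun h ↦ hp0 (expandAtInfty_injective σ e (h.trans (map_zero _).symm)))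
      (OfNat.ofNat_ne_zero 4)
  have hlt : (φ p / 4).orderTop < (z + φ b / 2).orderTop := by
    rcases eq_or_ne (z + φ b / 2) 0 with h0 | h0
    · rw [h0, HahnSeries.orderTop_zero]
      exact HahnSeries.orderTop_lt_top.mpr hφp
    rw [← HahnSeries.order_eq_orderTop_of_ne_zero h0,
      ← HahnSeries.order_eq_orderTop_of_ne_zero hφp, WithTop.coe_lt_coe, hord]
    by_contra! hle
    have h2 := two_pow_mul_order_ge σ e a b c hbc hz h0 hle
    have he0 : (0 : ℤ) < e := by exact_mod_cast NeZero.pos e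
    have h3 : (2 : ℤ) ^ (N + 1) * (z + φ b / 2).order ≤
        2 ^ (N + 1) * -((e : ℤ) * p.natDegree) := by gcongr
    have h4 : ((b ^ 2 - 4 * c + 4 * a).natDegree : ℤ) < 2 ^ (N + 1) := by exact_mod_cast hN
    have h5 : (1 : ℤ) ≤ p.natDegree := by exact_mod_cast hbc
    have h6 : (e : ℤ) * (b ^ 2 - 4 * c + 4 * a).natDegree < e * 2 ^ (N + 1) := by gcongr
    have h7 : (e : ℤ) * 2 ^ (N + 1) * 1 ≤ e * 2 ^ (N + 1) * p.natDegree := by gcongr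
    linarith
  have hsum : (z + φ b / 2 + φ p / 4).orderTop = (φ p / 4).orderTop :=
    HahnSeries.orderTop_add_eq_right hlt
  have hne : z + φ b / 2 + φ p / 4 ≠ 0 := by
    rw [← HahnSeries.orderTop_ne_top, hsum]
    exact HahnSeries.orderTop_ne_top.mpr hφp
  rw [h1]
  obtain ⟨r, hr⟩ := he
  refine LaurentSeries.isSquare_of_order_even (-((r : ℤ) * p.natDegree)) ?_ ?_
  · rw [← HahnSeries.order_eq_orderTop_of_ne_zero hne,
      ← HahnSeries.order_eq_orderTop_of_ne_zero hφp, hord, WithTop.coe_inj] at hsum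
    rw [hsum, hr]
    push_cast
    ring
  · rw [HahnSeries.leadingCoeff_add_eq_right hlt, expandAtInfty_div_four,
      leadingCoeff_expandAtInfty, leadingCoeff_mul, leadingCoeff_C, map_mul]
    exact IsSquare.mul ⟨σ 2⁻¹, by rw [← map_mul]; norm_num⟩ hσ

theorem splits_preimagePoly_of_le (a b c : K[X])
    (hbc : 0 < (b ^ 2 - 4 * c - 2 * b).natDegree) {k : ℕ}
    (hk : (b ^ 2 - 4 * c + 4 * a).natDegree < 2 ^ (k + 1)) (he : Even e)
    (hσ : IsSquare (σ (b ^ 2 - 4 * c - 2 * b).leadingCoeff))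
    (hs : ((preimagePoly a b c (k + 1)).map (expandAtInfty σ e)).Splits) {N : ℕ} (hN : k ≤ N) :
    ((preimagePoly a b c (N + 1)).map (expandAtInfty σ e)).Splits := by
  induction N, hN using Nat.le_induction with
  | base => exact hs
  | succ N hkN ih =>
    refine splits_preimagePoly_succ a b c ih fun z hz ↦
      isSquare_of_isRoot_preimagePoly σ e a b c hbc ?_ he hσ hz
    exact hk.trans_le (Nat.pow_le_pow_right two_pos (by omega))

end Splitting

/-- Finitely many elements of a finite extension acquire square roots in a larger one. -/
theorem exists_finiteDimensional_isSquare {K L : Type*} [Field K] [Field L] [Algebra K L]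
    [Algebra.IsAlgebraic K L] [IsAlgClosed L] (E : IntermediateField K L) [FiniteDimensional K E]
    (T : Finset E) :
    ∃ (E' : IntermediateField K L) (h : E ≤ E'), FiniteDimensional K E' ∧
      ∀ x ∈ T, IsSquare (IntermediateField.inclusion h x) := by
  classical
  choose r hr using fun x : E ↦ IsAlgClosed.exists_pow_nat_eq (x : L) two_pos
  have hfin : FiniteDimensional K (IntermediateField.adjoin K (T.image r : Set L)) :=
    IntermediateField.finiteDimensional_adjoin fun x _ ↦ Algebra.IsIntegral.isIntegral x
  refine ⟨E ⊔ IntermediateField.adjoin K (T.image r : Set L), le_sup_left, inferInstance,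
    fun x hx ↦ ?_⟩
  have hmem : r x ∈ E ⊔ IntermediateField.adjoin K (T.image r : Set L) :=
    (le_sup_right : _ ≤ E ⊔ _) (IntermediateField.subset_adjoin K _
      (Finset.mem_coe.mpr (Finset.mem_image_of_mem r hx)))
  refine ⟨⟨r x, hmem⟩, Subtype.ext ?_⟩
  simp [← hr x, sq]

/-- The first `n` preimages of `a` are Laurent series in `t ^ (-1 / 2 ^ n)` over a finite
extension. -/
theorem exists_splits_preimagePoly {K : Type*} (L : Type*) [Field K] [CharZero K] [Field L]
    [Algebra K L] [Algebra.IsAlgebraic K L] [IsAlgClosed L] (a b c : K[X]) (n : ℕ) :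
    ∃ E : IntermediateField K L, FiniteDimensional K E ∧ ∀ j ≤ n,
      ((preimagePoly a b c j).map (expandAtInfty (algebraMap K E) (2 ^ n))).Splits := by
  classical
  induction n with
  | zero =>
    refine ⟨⊥, inferInstance, fun j hj ↦ ?_⟩
    obtain rfl : j = 0 := by omega
    simp [preimagePoly_zero]
  | succ n ih =>
    obtain ⟨E, hE, hs⟩ := ih
    set φ := expandAtInfty (algebraMap K E) (2 ^ n) with hφ
    obtain ⟨E', hle, hE', hsq⟩ := exists_finiteDimensional_isSquare E
      (((preimagePoly a b c n).map φ).roots.toFinset.image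
        fun z ↦ (z + (φ b ^ 2 / 4 - φ c)).leadingCoeff)
    let ι : E →+* E' := (IntermediateField.inclusion hle).toRingHom
    let ψ : E⸨X⸩ →+* E'⸨X⸩ := (LaurentSeries.coeffMap ι).comp (LaurentSeries.dilate E 2)
    have hψ : ψ.comp φ = expandAtInfty (algebraMap K E') (2 ^ (n + 1)) := by
      rw [RingHom.comp_assoc, hφ, dilate_comp_expandAtInfty, coeffMap_comp_expandAtInfty, pow_succ']
      congr 1
    have hs' : ∀ j ≤ n,
        ((preimagePoly a b c j).map (expandAtInfty (algebraMap K E') (2 ^ (n + 1)))).Splits := by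
      intro j hj
      rw [← hψ, ← Polynomial.map_map]
      exact (hs j hj).map ψ
    refine ⟨E', hE', fun j hj ↦ ?_⟩
    rcases Nat.lt_or_ge n j with hlt | hge
    swap
    · exact hs' j hge
    obtain rfl : j = n + 1 := by omega
    refine splits_preimagePoly_succ a b c (hs' n le_rfl) fun z hz ↦ ?_
    have hm := monic_preimagePoly a b c n
    obtain ⟨y, rfl⟩ : z ∈ ψ.range := by
      refine (hs n le_rfl).mem_range_of_isRoot (i := ψ) (hm.map φ).ne_zero ?_
      rw [Polynomial.map_map, hψ, IsRoot.def, eval_map, hz]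
    have hy : y ∈ ((preimagePoly a b c n).map φ).roots := by
      rw [mem_roots (hm.map φ).ne_zero, IsRoot.def, eval_map]
      apply ψ.injective
      rw [hom_eval₂, hψ, hz, map_zero]
    rw [← hψ]
    simp only [RingHom.comp_apply]
    set u := y + (φ b ^ 2 / 4 - φ c) with hu
    have hu' : ψ y + (ψ (φ b) ^ 2 / 4 - ψ (φ c)) = ψ u := by
      rw [hu, map_add, map_sub, map_div₀, map_pow, map_ofNat]
    rw [hu']
    rcases eq_or_ne u 0 with h0 | h0
    · rw [h0, map_zero]
      exact ⟨0, by simp⟩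
    have hd0 : LaurentSeries.dilate E 2 u ≠ 0 := (_root_.map_ne_zero _).mpr h0
    have hord : (ψ u).order = 2 * u.order := by
      rw [RingHom.comp_apply, LaurentSeries.order_coeffMap _ hd0, LaurentSeries.order_dilate _ h0,
        Nat.cast_ofNat]
    refine LaurentSeries.isSquare_of_order_even u.order (by rw [hord, two_mul]) ?_
    have hlc : (ψ u).leadingCoeff = ι u.leadingCoeff := by
      rw [HahnSeries.leadingCoeff_eq, hord, RingHom.comp_apply, LaurentSeries.coeff_coeffMap,
        HahnSeries.leadingCoeff_eq, ← LaurentSeries.coeff_dilate_mul 2 u, Nat.cast_ofNat]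
    rw [hlc]
    exact hsq _ (Finset.mem_image_of_mem _ (Multiset.mem_toFinset.mpr hy))

/-! ### Components of the preimage curves -/

/-- A minimal prime over a monic polynomial in `x` is generated by a monic irreducible factor. -/
theorem exists_monic_of_mem_minimalPrimes {R : Type*} [CommRing R] [IsDomain R]
    [UniqueFactorizationMonoid R] {P : R[X]} (hP : P.Monic) {𝔭 : Ideal R[X]} [𝔭.IsPrime]
    (h : 𝔭 ∈ (Ideal.span {P}).minimalPrimes) :
    ∃ F : R[X], F.Monic ∧ F ∣ P ∧ 𝔭 = Ideal.span {F} := by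
  have hP𝔭 : P ∈ 𝔭 := h.1.2 (Ideal.mem_span_singleton_self P)
  obtain ⟨s, hs, u, hu⟩ := UniqueFactorizationMonoid.exists_prime_factors P hP.ne_zero
  have hmem : s.prod ∈ 𝔭 := by
    rw [← hu] at hP𝔭
    exact (Ideal.IsPrime.mem_or_mem inferInstance hP𝔭).resolve_right
      fun hmem ↦ Ideal.IsPrime.ne_top inferInstance (Ideal.eq_top_of_isUnit_mem _ hmem u.isUnit)
  obtain ⟨F, hFs, hF𝔭⟩ := (Ideal.IsPrime.multiset_prod_mem_iff_exists_mem inferInstance s).mp hmem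
  have hFP : F ∣ P := (Multiset.dvd_prod hFs).trans ⟨u, hu.symm⟩
  have hprime := hs F hFs
  have h𝔭 : 𝔭 = Ideal.span {F} := by
    have hle : Ideal.span {F} ≤ 𝔭 := (Ideal.span_singleton_le_iff_mem _).mpr hF𝔭
    refine le_antisymm (h.2 ⟨?_, ?_⟩ hle) hle
    · exact (Ideal.span_singleton_prime hprime.ne_zero).mpr hprime
    · exact Ideal.span_singleton_le_span_singleton.mpr hFP
  have hunit : IsUnit F.leadingCoeff := by
    obtain ⟨H, hH⟩ := hFP
    refine .of_mul_eq_one H.leadingCoeff ?_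
    rw [← leadingCoeff_mul, ← hH, hP.leadingCoeff]
  obtain ⟨v, hv⟩ := hunit
  have hass : Associated F (C (↑v⁻¹ : R) * F) :=
    (associated_unit_mul_left F _ (isUnit_C.mpr v⁻¹.isUnit)).symm
  refine ⟨C (↑v⁻¹ : R) * F, ?_, hass.symm.dvd.trans hFP, ?_⟩
  · rw [Monic, leadingCoeff_mul, leadingCoeff_C, ← hv, Units.inv_mul]
  · rw [h𝔭, Ideal.span_singleton_eq_span_singleton]
    exact hass

/-- The contraction of the ideal generated by a monic polynomial under an extension of scalars. -/
theorem comap_span_map_singleton {R S : Type*} [CommRing R] [CommRing S] {f : R →+* S}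
    (hf : Function.Injective f) {G : R[X]} (hG : G.Monic) :
    (Ideal.span {G.map f}).comap (mapRingHom f) = Ideal.span {G} := by
  ext H
  rw [Ideal.mem_comap, Ideal.mem_span_singleton, Ideal.mem_span_singleton, coe_mapRingHom,
    map_dvd_map f hf hG]

/-- If `P` splits over `k((s))`, where `t = s ^ (-e)`, then every monic factor of `P` over an
extension `L` of `k` has its coefficients in `k`. -/
theorem exists_monic_map_eq_of_dvd {k L : Type*} [Field k] [Field L] (τ : k →+* L) (e : ℕ)
    [NeZero e]
    {P : k[X][X]} (hP : P.Monic) (hs : (P.map (expandAtInfty (RingHom.id k) e)).Splits)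
    {F : L[X][X]} (hF : F.Monic) (hFP : F ∣ P.map (mapRingHom τ)) :
    ∃ G : k[X][X], G.Monic ∧ G.map (mapRingHom τ) = F := by
  set φ := expandAtInfty (RingHom.id k) e
  set φL := expandAtInfty (RingHom.id L) e
  have hcomm : φL.comp (mapRingHom τ) = (LaurentSeries.coeffMap τ).comp φ := by
    rw [expandAtInfty_comp_map, coeffMap_comp_expandAtInfty]
    rfl
  have hmap : (P.map (mapRingHom τ)).map φL = (P.map φ).map (LaurentSeries.coeffMap τ) := by
    rw [Polynomial.map_map, Polynomial.map_map, hcomm]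
  have hdvd : F.map φL ∣ (P.map φ).map (LaurentSeries.coeffMap τ) :=
    hmap ▸ Polynomial.map_dvd φL hFP
  have hFs : (F.map φL).Splits := (hs.map _).of_dvd ((hP.map _).map _).ne_zero hdvd
  have hlift := hFs.mem_lift_of_roots_mem_range (hF.map φL) (LaurentSeries.coeffMap τ)
    fun z hz ↦ hs.mem_range_of_isRoot (hP.map φ).ne_zero
      (IsRoot.dvd ((mem_roots (hF.map φL).ne_zero).mp hz) hdvd)
  rw [lifts_iff_coeff_lifts] at hlift
  have hFlift : F ∈ lifts (mapRingHom τ) := by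
    rw [lifts_iff_coeff_lifts]
    intro n
    obtain ⟨g, hg⟩ := hlift n
    rw [coeff_map] at hg
    have hcoeff : F.coeff n ∈ lifts τ := by
      rw [lifts_iff_coeff_lifts]
      intro m
      refine ⟨g.coeff (-((e : ℤ) * m)), ?_⟩
      rw [← LaurentSeries.coeff_coeffMap, hg]
      exact coeff_expandAtInfty (RingHom.id L) e (F.coeff n) m
    obtain ⟨q, hq⟩ := (mem_lifts _).mp hcoeff
    exact ⟨q, hq⟩
  obtain ⟨G, hG, -, hGm⟩ := lifts_and_natDegree_eq_and_monic hFlift hF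
  exact ⟨G, hGm, hG⟩

/-- All iterated preimages of `a` are Laurent series in `t ^ (-1 / e)` over one finite extension
`E`, for some `e ≤ 2 * (1 + deg (b² - 4c + 4a))`. -/
theorem exists_forall_splits_preimagePoly {K : Type*} (L : Type*) [Field K] [CharZero K] [Field L]
    [Algebra K L] [Algebra.IsAlgebraic K L] [IsAlgClosed L] (a b c : K[X])
    (hbc : 0 < (b ^ 2 - 4 * c - 2 * b).natDegree) :
    ∃ (E : IntermediateField K L) (e : ℕ), FiniteDimensional K E ∧ e ≠ 0 ∧
      e ≤ 2 * (1 + (b ^ 2 - 4 * c + 4 * a).natDegree) ∧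
      ∀ N, ((preimagePoly a b c N).map (expandAtInfty (algebraMap K E) e)).Splits := by
  set m := (b ^ 2 - 4 * c + 4 * a).natDegree with hm
  set k := Nat.log 2 (m + 1) with hk
  have hlt : m < 2 ^ (k + 1) :=
    (Nat.lt_succ_self m).trans (Nat.lt_pow_succ_log_self one_lt_two (m + 1))
  have hle : 2 ^ (k + 1) ≤ 2 * (1 + m) := by
    rw [pow_succ', add_comm 1 m]
    gcongr
    exact Nat.pow_log_le_self 2 (Nat.succ_ne_zero m)
  obtain ⟨E, hE, hs⟩ := exists_splits_preimagePoly L a b c (k + 1)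
  obtain ⟨E', hEE', hE', hsq⟩ := exists_finiteDimensional_isSquare E
    {algebraMap K E (b ^ 2 - 4 * c - 2 * b).leadingCoeff}
  have hs' : ∀ j ≤ k + 1,
      ((preimagePoly a b c j).map (expandAtInfty (algebraMap K E') (2 ^ (k + 1)))).Splits := by
    intro j hj
    have h := (hs j hj).map
      (LaurentSeries.coeffMap (IntermediateField.inclusion hEE').toRingHom)
    rw [Polynomial.map_map, coeffMap_comp_expandAtInfty] at h
    exact h
  refine ⟨E', 2 ^ (k + 1), hE', by positivity, hle, fun N ↦ ?_⟩
  rcases Nat.lt_or_ge N (k + 1) with hN | hN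
  · exact hs' N hN.le
  obtain ⟨N, rfl⟩ : ∃ n, N = n + 1 := ⟨N - 1, by omega⟩
  refine splits_preimagePoly_of_le (algebraMap K E') (2 ^ (k + 1)) a b c hbc hlt
    (Even.pow_of_ne_zero even_two (Nat.succ_ne_zero k)) ?_ (hs' _ le_rfl) (by omega)
  exact hsq _ (Finset.mem_singleton_self _)

theorem theorem4p7 {K : Type*} [Field K] [NumberField K] (a b c : K[X])
    (hbc : 0 < (b ^ 2 - 4 * c - 2 * b).natDegree) :
    ∃ K' : IntermediateField K (AlgebraicClosure K), NumberField K' ∧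
      ∀ N : ℕ, 0 < N →
      ∀ (𝔭 : Ideal (AlgebraicClosure K)[X][X]) [𝔭.IsPrime],
        𝔭 ∈ (preimageIdeal (AlgebraicClosure K) a b c N).minimalPrimes →
        IsDefinedOver K' 𝔭 ∧
        ∃ F : (AlgebraicClosure K)[X][X], Ideal.span {F} = 𝔭 ∧
          ∃ S : Finset (ValuationSubring (FractionRing (K'[X][X] ⧸ descendIdeal K' 𝔭))),
            (∀ V ∈ S, V ∈ rationalPointsAtInfinity K' (K'[X][X] ⧸ descendIdeal K' 𝔭)) ∧
            (F.natDegree : ℝ) / (4 * (1 + ((b ^ 2 - 4 * c + 4 * a).natDegree : ℝ))) ≤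
              (S.card : ℝ) := by
  obtain ⟨K', e, hfin, he0, he, hs⟩ :=
    exists_forall_splits_preimagePoly (AlgebraicClosure K) a b c hbc
  have : NeZero e := ⟨he0⟩
  have hK' : NumberField K' := NumberField.of_module_finite K K'
  refine ⟨K', hK', fun N _ 𝔭 _ h𝔭 ↦ ?_⟩
  set P : K'[X][X] := (preimagePoly a b c N).map (mapRingHom (algebraMap K K')) with hPdef
  have hP : P.Monic := (monic_preimagePoly a b c N).map _
  have hPs : (P.map (expandAtInfty (RingHom.id K') e)).Splits := by
    rw [hPdef, Polynomial.map_map, expandAtInfty_comp_map, RingHom.id_comp]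
    exact hs N
  let τ : K' →+* AlgebraicClosure K := algebraMap K' (AlgebraicClosure K)
  have hPτ : extendScalars K (AlgebraicClosure K) (preimagePoly a b c N) =
      P.map (mapRingHom τ) := by
    rw [hPdef, Polynomial.map_map, mapRingHom_comp, ← IsScalarTower.algebraMap_eq]
    rfl
  rw [preimageIdeal, hPτ] at h𝔭
  obtain ⟨F, hF, hFP, h𝔭F⟩ := exists_monic_of_mem_minimalPrimes (hP.map (mapRingHom τ)) h𝔭
  obtain ⟨G, hG, hGF⟩ := exists_monic_map_eq_of_dvd τ e hP hPs hF hFP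
  have hτ : Function.Injective (mapRingHom τ) := map_injective τ τ.injective
  have hGP : G ∣ P := by
    rw [← hGF, map_dvd_map _ hτ hG] at hFP
    exact hFP
  have hGs : (G.map (expandAtInfty (RingHom.id K') e)).Splits :=
    hPs.of_dvd (hP.map _).ne_zero (Polynomial.map_dvd _ hGP)
  have hdesc : descendIdeal K' 𝔭 = Ideal.span {G} := by
    rw [h𝔭F, ← hGF]
    exact comap_span_map_singleton hτ hG
  refine ⟨⟨Ideal.span {G}, ?_⟩, F, h𝔭F.symm, ?_⟩
  · rw [Ideal.map_span, Set.image_singleton, h𝔭F, ← hGF]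
    rfl
  obtain ⟨S, hS, hcard⟩ := exists_rationalPointsAtInfinity (A := K'[X][X] ⧸ descendIdeal K' 𝔭) e hG
    (q := Ideal.Quotient.mk (descendIdeal K' 𝔭)) Ideal.Quotient.mk_surjective
    (by rw [Ideal.mk_ker, hdesc]) (fun r ↦ rfl) hGs
  refine ⟨S, hS, ?_⟩
  rw [← hGF, hG.natDegree_map, div_le_iff₀ (by positivity)]
  have h1 : (G.natDegree : ℝ) ≤ e * S.card := by exact_mod_cast hcard
  have h2 : (e : ℝ) ≤ 2 * (1 + (b ^ 2 - 4 * c + 4 * a).natDegree) := by exact_mod_cast he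
  refine h1.trans ?_
  rw [mul_comm]
  gcongr
  linarith [Nat.cast_nonneg (α := ℝ) (b ^ 2 - 4 * c + 4 * a).natDegree]
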